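/- Work in $\mathbb R^n$. For a Lebesgue measurable set $F$, let $\operatorname{Per}(F)\in[0,\infty]$ be its (De Giorgi) perimeter, i.e. the supremum of $\int_F\operatorname{div}\varphi$ over all $\varphi\in C^1_c(\mathbb R^n;\mathbb R^n)$ with $|\varphi|\le 1$, and let $d_E$ be the signed distance function to a set $E$, positive outside $E$ and negative inside. A set $E\subset\mathbb R^n$ is called a minimizing hull if $|\partial E|=0$ and $\operatorname{Per}(E)\le\operatorname{Per}(F)$ for every $F\supset E$ with $F\setminus E$ compact. Given $h>0$, a set $E$ and an obstacle $\Omega\subset\mathbb R^n$, consider the problem $$\min\Big\{\operatorname{Per}(F)+\frac1h\int_{F\Delta E}|d_E|\,dx \;:\; F \text{ of finite perimeter},\ \Omega\subset F\Big\}.\qquad(P_\Omega)$$ A minimizer of $(P_\Omega)$ is called maximal if it contains every other minimizer of $(P_\Omega)$ up to a Lebesgue null set. Let $h>0$ and let $E$ be a minimizing hull containing $\Omega$. Let $E^f$ be the free evolution of $E$, i.e. the maximal minimizer of $(P_\emptyset)$ (no obstacle), and let $E^c$ be the constrained evolution of $E$, i.e. the maximal minimizer of $(P_\Omega)$. Then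 $E^f\cup\Omega\subset E^c$, where the inclusion $E^f\subset E^c$ holds up to a Lebesgue null set and $\Omega\subset E^c$ holds pointwise. -/

import Mathlib

open MeasureTheory Set

noncomputable section

namespace ObstacleFlow

/-- Euclidean space `ℝⁿ`. -/
abbrev Rn (n : ℕ) : Type := EuclideanSpace ℝ (Fin n)

/-- Divergence `∑ᵢ ∂ᵢ φᵢ` of a vector field. -/
def divergence {n : ℕ} (φ : Rn n → Rn n) (x : Rn n) : ℝ :=
  ∑ i : Fin n, (fderiv ℝ φ x (EuclideanSpace.single i 1)) i

/-- De Giorgi's perimeter in `ℝⁿ`, with values in `[0, ∞]`: the supremum of `∫_E div φ` over all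
`C¹` vector fields `φ` with compact support and `|φ| ≤ 1`. -/
def perimeter {n : ℕ} (E : Set (Rn n)) : ENNReal :=
  ⨆ (φ : Rn n → Rn n) (_ : ContDiff ℝ 1 φ) (_ : HasCompactSupport φ) (_ : ∀ x, ‖φ x‖ ≤ 1),
    ENNReal.ofReal (∫ x in E, divergence φ x)

/-- Lebesgue measurable sets of finite perimeter. -/
def FinitePerimeter {n : ℕ} (E : Set (Rn n)) : Prop :=
  NullMeasurableSet E volume ∧ perimeter E < ⊤

/-- Signed distance to `E`, positive outside `E` and negative inside. At each point one of the two
terms vanishes. It is extended-real valued, so that the distance to the empty set is `+∞`. -/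
def signedDistance {n : ℕ} (E : Set (Rn n)) (x : Rn n) : EReal :=
  (Metric.infEDist x E : EReal) - (Metric.infEDist x Eᶜ : EReal)

/-- The energy `Per(F) + (1/h) ∫_{F Δ E} |d_E|` of one step of the scheme starting from `E`. -/
def energy {n : ℕ} (h : ℝ) (E F : Set (Rn n)) : ENNReal :=
  perimeter F + ENNReal.ofReal (1 / h) * ∫⁻ x in symmDiff F E, (signedDistance E x).abs

/-- `F` minimizes the energy among the sets of finite perimeter that contain the obstacle `Ω`. -/
def IsMinimizer {n : ℕ} (h : ℝ) (Ω E F : Set (Rn n)) : Prop :=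
  FinitePerimeter F ∧ Ω ⊆ F ∧
    ∀ G : Set (Rn n), FinitePerimeter G → Ω ⊆ G → energy h E F ≤ energy h E G

/-- `F` is the maximal minimizer: it contains every other minimizer. The energy does not see
Lebesgue null sets, so this inclusion is up to a null set. -/
def IsMaximalMinimizer {n : ℕ} (h : ℝ) (Ω E F : Set (Rn n)) : Prop :=
  IsMinimizer h Ω E F ∧ ∀ G : Set (Rn n), IsMinimizer h Ω E G → G ≤ᵐ[volume] F

/-- Minimizing hulls: the boundary is Lebesgue null, and adding a compact set never decreases the
perimeter. -/
def IsMinimizingHull {n : ℕ} (E : Set (Rn n)) : Prop :=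
  volume (frontier E) = 0 ∧
    ∀ F : Set (Rn n), E ⊆ F → IsCompact (F \ E) → perimeter E ≤ perimeter F

end ObstacleFlow

end

/-! The energy is submodular: perimeter satisfies `Per(A ∩ B) + Per(A ∪ B) ≤ Per(A) + Per(B)`, and
the distance term gives equality. Since `Ef ∩ Ec` competes with `Ef` in the free problem, cancelling
the energy of `Ef` shows that `Ef ∪ Ec` has at most the energy of `Ec`. The union contains `Ω`, so
it is a constrained minimizer (`IsMinimizer.union`), and maximality of `Ec` absorbs it. Cancellation
needs finite energy; when the constrained minimum is `⊤`, the whole space is a minimizer, so `Ec`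
has null complement.

The substance is `perimeter_inter_add_perimeter_union_le`. Mollify the two indicators to `u`, `v`
and form a smoothed minimum and maximum. Their gradients are complementary convex combinations of
those of `u` and `v`. Integration by parts moves the weights onto the test fields, which stay
admissible because the unit ball is convex. Then let the regularisation tend to zero. -/

noncomputable section

namespace ObstacleFlow

open Filter Topology
open scoped Convolution

variable {n : ℕ}

/-! ### Test fields, divergence and perimeter. -/

/-- Admissible test fields in the definition of the perimeter. -/
structure IsTestField (φ : Rn n → Rn n) : Prop where
  contDiff : ContDiff ℝ 1 φ
  hasCompactSupport : HasCompactSupport φ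
  norm_le : ∀ x, ‖φ x‖ ≤ 1

lemma isTestField_zero : IsTestField (0 : Rn n → Rn n) :=
  ⟨contDiff_const, HasCompactSupport.zero, fun x => by simp⟩

lemma IsTestField.comp_add_right {φ : Rn n → Rn n} (hφ : IsTestField φ) (t : Rn n) :
    IsTestField (fun x => φ (x + t)) :=
  ⟨hφ.contDiff.comp (contDiff_id.add contDiff_const),
    hφ.hasCompactSupport.comp_homeomorph (Homeomorph.addRight t), fun _ => hφ.norm_le _⟩

/-- Test fields are stable under convex combinations with `C¹` weights. -/
lemma IsTestField.convexCombination {φ ψ : Rn n → Rn n} (hφ : IsTestField φ) (hψ : IsTestField ψ)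
    {s : Rn n → ℝ} (hs : ContDiff ℝ 1 s) (h0 : ∀ x, 0 ≤ s x) (h1 : ∀ x, s x ≤ 1) :
    IsTestField (fun x => s x • φ x + (1 - s x) • ψ x) where
  contDiff := (hs.smul hφ.contDiff).add ((contDiff_const.sub hs).smul hψ.contDiff)
  hasCompactSupport :=
    (hφ.hasCompactSupport.smul_left (f := s)).add
      (hψ.hasCompactSupport.smul_left (f := fun x => 1 - s x))
  norm_le x := by
    have hs1 : 0 ≤ 1 - s x := sub_nonneg.2 (h1 x)
    calc ‖s x • φ x + (1 - s x) • ψ x‖ ≤ ‖s x • φ x‖ + ‖(1 - s x) • ψ x‖ := norm_add_le _ _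
      _ = s x * ‖φ x‖ + (1 - s x) * ‖ψ x‖ := by
        rw [norm_smul, norm_smul, Real.norm_of_nonneg (h0 x), Real.norm_of_nonneg hs1]
      _ ≤ s x * 1 + (1 - s x) * 1 :=
        add_le_add (mul_le_mul_of_nonneg_left (hφ.norm_le x) (h0 x))
          (mul_le_mul_of_nonneg_left (hψ.norm_le x) hs1)
      _ = 1 := by ring

/-- A single supremum over a nonempty type lets a sum of two perimeters be bounded one pair of
fields at a time. -/
lemma perimeter_eq_iSup_subtype (E : Set (Rn n)) :
    perimeter E = ⨆ φ : {φ : Rn n → Rn n // IsTestField φ},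
      ENNReal.ofReal (∫ x in E, divergence φ.1 x) := by
  refine le_antisymm ?_ ?_
  · refine iSup_le fun φ => iSup_le fun h1 => iSup_le fun h2 => iSup_le fun h3 => ?_
    exact le_iSup (fun φ : {φ : Rn n → Rn n // IsTestField φ} =>
      ENNReal.ofReal (∫ x in E, divergence φ.1 x)) ⟨φ, h1, h2, h3⟩
  · refine iSup_le fun φ => ?_
    exact le_iSup_of_le φ.1 (le_iSup_of_le φ.2.1 (le_iSup_of_le φ.2.2 (le_iSup_of_le φ.2.3 le_rfl)))

lemma IsTestField.setIntegral_divergence_le {φ : Rn n → Rn n} (hφ : IsTestField φ)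
    {E : Set (Rn n)} (hE : perimeter E ≠ ⊤) :
    ∫ x in E, divergence φ x ≤ (perimeter E).toReal := by
  rw [← ENNReal.ofReal_le_iff_le_toReal hE, perimeter_eq_iSup_subtype]
  exact le_iSup (fun φ : {φ : Rn n → Rn n // IsTestField φ} =>
      ENNReal.ofReal (∫ x in E, divergence φ.1 x)) ⟨φ, hφ⟩

lemma perimeter_congr_ae {E F : Set (Rn n)} (h : E =ᵐ[volume] F) : perimeter E = perimeter F := by
  simp only [perimeter, setIntegral_congr_set h]

lemma continuous_divergence {φ : Rn n → Rn n} (hφ : ContDiff ℝ 1 φ) :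
    Continuous (divergence φ) := by
  have := hφ.continuous_fderiv one_ne_zero
  unfold divergence
  fun_prop

lemma hasCompactSupport_divergence {φ : Rn n → Rn n} (hφ : HasCompactSupport φ) :
    HasCompactSupport (divergence φ) := by
  refine (hφ.fderiv ℝ).mono fun x hx hx0 => hx ?_
  simp [divergence, hx0]

lemma integrable_divergence {φ : Rn n → Rn n} (hφ : ContDiff ℝ 1 φ) (hc : HasCompactSupport φ) :
    Integrable (divergence φ) :=
  (continuous_divergence hφ).integrable_of_hasCompactSupport (hasCompactSupport_divergence hc)

lemma divergence_smul {f : Rn n → ℝ} {φ : Rn n → Rn n} {x : Rn n} (hf : DifferentiableAt ℝ f x)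
    (hφ : DifferentiableAt ℝ φ x) :
    divergence (fun y => f y • φ y) x = f x * divergence φ x + fderiv ℝ f x (φ x) := by
  have key : fderiv ℝ f x (φ x) =
      ∑ i, fderiv ℝ f x (EuclideanSpace.single i 1) * φ x i := by
    conv_lhs => rw [← (EuclideanSpace.basisFun (Fin n) ℝ).sum_repr (φ x)]
    simp [mul_comm]
  rw [key]
  simp [divergence, fderiv_fun_smul hf hφ, Finset.sum_add_distrib, Finset.mul_sum]

lemma divergence_comp_add_right (φ : Rn n → Rn n) (t x : Rn n) :
    divergence (fun y => φ (y + t)) x = divergence φ (x + t) := by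
  simp [divergence, fderiv_comp_add_right]

/-- The divergence theorem for compactly supported fields. -/
lemma integral_divergence_eq_zero {φ : Rn n → Rn n} (hφ : ContDiff ℝ 1 φ)
    (hc : HasCompactSupport φ) : ∫ x, divergence φ x = 0 := by
  have hcont := hφ.continuous_fderiv one_ne_zero
  have hint : ∀ i : Fin n,
      Integrable (fun x => fderiv ℝ φ x (EuclideanSpace.single i 1)) := fun i =>
    Continuous.integrable_of_hasCompactSupport (by fun_prop) (hc.fderiv_apply ℝ _)
  have hzero : ∀ v : Rn n, ∫ x, fderiv ℝ φ x v = 0 := fun v => by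
    -- Integration by parts against the constant function `1`.
    have := integral_smul_fderiv_eq_neg_fderiv_smul_of_integrable (μ := (volume : Measure (Rn n)))
      (f := fun _ : Rn n => (1 : ℝ)) (g := φ) (v := v) (by simp)
      (by simpa using Continuous.integrable_of_hasCompactSupport (by fun_prop) (hc.fderiv_apply ℝ v))
      (by simpa using hφ.continuous.integrable_of_hasCompactSupport hc)
      (fun x _ => differentiableAt_const _) (fun x _ => (hφ.differentiable one_ne_zero) x)
    simpa using this
  unfold divergence
  have hcoord : ∀ i : Fin n, ∀ x, (fderiv ℝ φ x (EuclideanSpace.single i 1)) i =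
      (EuclideanSpace.proj i : Rn n →L[ℝ] ℝ) (fderiv ℝ φ x (EuclideanSpace.single i 1)) :=
    fun i x => rfl
  simp_rw [hcoord]
  rw [integral_finsetSum _ fun i _ => ContinuousLinearMap.integrable_comp _ (hint i)]
  refine Finset.sum_eq_zero fun i _ => ?_
  rw [ContinuousLinearMap.integral_comp_comm _ (hint i), hzero, map_zero]

lemma perimeter_univ : perimeter (univ : Set (Rn n)) = 0 := by
  rw [perimeter_eq_iSup_subtype]
  refine le_antisymm (iSup_le fun φ => ?_) bot_le
  rw [setIntegral_univ, integral_divergence_eq_zero φ.2.contDiff φ.2.hasCompactSupport]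
  simp

/-! ### Mollified indicators. -/

/-- A mollification of the indicator of `A` is smooth, takes values in `[0, 1]`, and its total
variation is at most the perimeter of `A`. -/
lemma mollification_properties {A : Set (Rn n)} (hA : MeasurableSet A) (hP : perimeter A ≠ ⊤)
    (ρ : ContDiffBump (0 : Rn n)) {u : Rn n → ℝ}
    (hu : u = ρ.normed volume ⋆[ContinuousLinearMap.lsmul ℝ ℝ, volume]
      A.indicator (fun _ => (1 : ℝ))) :
    ContDiff ℝ 2 u ∧ (∀ x, 0 ≤ u x) ∧ (∀ x, u x ≤ 1) ∧
      ∀ X, IsTestField X → ∫ x, u x * divergence X x ≤ (perimeter A).toReal := by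
  set g : Rn n → ℝ := A.indicator (fun _ => (1 : ℝ)) with hg
  have hgm : Measurable g := measurable_const.indicator hA
  have hg0 : ∀ x, 0 ≤ g x := fun x => indicator_nonneg (fun _ _ => zero_le_one) x
  have hg1 : ∀ x, g x ≤ 1 := fun x => indicator_le_self' (fun _ _ => zero_le_one) x
  have hgn : ∀ x, ‖g x‖ ≤ 1 := fun x => by rw [Real.norm_of_nonneg (hg0 x)]; exact hg1 x
  have hgl : LocallyIntegrable g volume :=
    (locallyIntegrable_const (1 : ℝ)).mono hgm.aestronglyMeasurable
      (ae_of_all _ fun x => by simpa using hgn x)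
  have hr0 : ∀ t, 0 ≤ ρ.normed volume t := ρ.nonneg_normed
  have hri : Integrable (ρ.normed volume) := ρ.integrable_normed
  have hux : ∀ x, u x = ∫ t, ρ.normed volume t * g (x - t) := fun x => by
    rw [hu]; rfl
  have hrg : ∀ x, Integrable fun t => ρ.normed volume t * g (x - t) := fun x => by
    refine hri.mul_bdd (c := 1) ?_ (ae_of_all _ fun t => hgn _)
    exact (hgm.comp (measurable_const.sub measurable_id)).aestronglyMeasurable
  refine ⟨?_, fun x => ?_, fun x => ?_, fun X hX => ?_⟩
  · rw [hu]
    exact ρ.hasCompactSupport_normed.contDiff_convolution_left _ ρ.contDiff_normed hgl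
  · rw [hux]
    exact integral_nonneg fun t => mul_nonneg (hr0 t) (hg0 _)
  · rw [hux, ← ρ.integral_normed (μ := volume)]
    exact integral_mono (hrg x) hri fun t => mul_le_of_le_one_right (hr0 t) (hg1 _)
  · have hD : Integrable (divergence X) := integrable_divergence hX.contDiff hX.hasCompactSupport
    -- The mollification averages translates of the indicator. Testing a translate against `X` is
    -- testing `A` against a translate of `X`, so each slice obeys the same bound.
    have hslice : ∀ t, ∫ x, g (x - t) * divergence X x ≤ (perimeter A).toReal := fun t => by
      have h1 : ∫ x, g (x - t) * divergence X x = ∫ x in A, divergence (fun y => X (y + t)) x := by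
        rw [← integral_add_right_eq_self (fun x => g (x - t) * divergence X x) t,
          ← integral_indicator hA]
        refine integral_congr_ae (ae_of_all _ fun x => ?_)
        by_cases hx : x ∈ A <;> simp [hg, hx, divergence_comp_add_right]
      rw [h1]
      exact (hX.comp_add_right t).setIntegral_divergence_le hP
    have hprod : Integrable (Function.uncurry fun x t =>
        ρ.normed volume t * (g (x - t) * divergence X x))
        ((volume : Measure (Rn n)).prod volume) := by
      have := (hD.mul_prod hri).bdd_mul (f := fun p : Rn n × Rn n => g (p.1 - p.2)) (c := 1)
        (hgm.comp (measurable_fst.sub measurable_snd)).aestronglyMeasurable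
        (ae_of_all _ fun p => hgn _)
      refine this.congr (ae_of_all _ fun p => ?_)
      simp only [Function.uncurry]
      ring
    calc ∫ x, u x * divergence X x
        = ∫ x, ∫ t, ρ.normed volume t * (g (x - t) * divergence X x) := by
          refine integral_congr_ae (ae_of_all _ fun x => ?_)
          simp only [hux, ← integral_mul_const, mul_assoc]
      _ = ∫ t, ∫ x, ρ.normed volume t * (g (x - t) * divergence X x) :=
          integral_integral_swap hprod
      _ = ∫ t, ρ.normed volume t * ∫ x, g (x - t) * divergence X x := by
          simp only [integral_const_mul]
      _ ≤ ∫ t, ρ.normed volume t * (perimeter A).toReal := by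
          refine integral_mono ?_ (hri.mul_const _) fun t =>
            mul_le_mul_of_nonneg_left (hslice t) (hr0 t)
          simpa only [Function.uncurry, integral_const_mul] using hprod.integral_prod_right
      _ = (perimeter A).toReal := by
          rw [integral_mul_const, ρ.integral_normed, one_mul]

lemma exists_smooth_approximation {A : Set (Rn n)} (hA : MeasurableSet A)
    (hP : perimeter A ≠ ⊤) :
    ∃ u : ℕ → Rn n → ℝ, (∀ k, ContDiff ℝ 2 (u k)) ∧ (∀ k x, 0 ≤ u k x) ∧ (∀ k x, u k x ≤ 1) ∧
      (∀ k X, IsTestField X → ∫ x, u k x * divergence X x ≤ (perimeter A).toReal) ∧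
      ∀ᵐ x, Tendsto (fun k => u k x) atTop (𝓝 (A.indicator (fun _ => (1 : ℝ)) x)) := by
  let ρ : ℕ → ContDiffBump (0 : Rn n) := fun k =>
    { rIn := 1 / ((k : ℝ) + 1)
      rOut := 2 * (1 / ((k : ℝ) + 1))
      rIn_pos := Nat.one_div_pos_of_nat
      rIn_lt_rOut := by linarith [Nat.one_div_pos_of_nat (α := ℝ) (n := k)] }
  have hgl : LocallyIntegrable (A.indicator fun _ => (1 : ℝ)) (volume : Measure (Rn n)) :=
    (locallyIntegrable_const (1 : ℝ)).indicator hA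
  have h := fun k => mollification_properties hA hP (ρ k) rfl
  refine ⟨fun k => (ρ k).normed volume ⋆[ContinuousLinearMap.lsmul ℝ ℝ, volume]
      A.indicator (fun _ => (1 : ℝ)), fun k => (h k).1, fun k => (h k).2.1, fun k => (h k).2.2.1,
    fun k => (h k).2.2.2, ?_⟩
  -- Lebesgue differentiation needs `rOut ≤ K * rIn` with `K` fixed, hence the constant ratio `2` in
  -- `ρ`.
  refine ContDiffBump.ae_convolution_tendsto_right_of_locallyIntegrable (K := 2) ?_
    (Eventually.of_forall fun k => le_rfl) hgl
  simpa [ρ] using (tendsto_one_div_add_atTop_nhds_zero_nat (𝕜 := ℝ)).const_mul 2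

/-! ### Smoothed minimum and maximum. -/

/-- A smooth regularisation of `|a - b|`. -/
def smoothDist (d a b : ℝ) : ℝ := √((a - b) ^ 2 + d ^ 2)

lemma smoothDist_pos {d : ℝ} (hd : 0 < d) (a b : ℝ) : 0 < smoothDist d a b :=
  Real.sqrt_pos.2 (by positivity)

lemma abs_sub_le_smoothDist (d a b : ℝ) : |a - b| ≤ smoothDist d a b :=
  Real.abs_le_sqrt (by nlinarith [sq_nonneg d])

lemma smoothDist_le_two {d a b : ℝ} (hd0 : 0 ≤ d) (hd : d ≤ 1) (ha0 : 0 ≤ a) (ha1 : a ≤ 1)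
    (hb0 : 0 ≤ b) (hb1 : b ≤ 1) : smoothDist d a b ≤ 2 :=
  Real.sqrt_le_iff.2 ⟨by norm_num, by nlinarith⟩

lemma hasFDerivAt_smoothDist {d : ℝ} (hd : 0 < d) {u v : Rn n → ℝ} {x : Rn n}
    (hu : DifferentiableAt ℝ u x) (hv : DifferentiableAt ℝ v x) :
    HasFDerivAt (fun y => smoothDist d (u y) (v y))
      (((u x - v x) / smoothDist d (u x) (v x)) • (fderiv ℝ u x - fderiv ℝ v x)) x := by
  have hpos : 0 < (u x - v x) ^ 2 + d ^ 2 := by positivity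
  have h1 := (((hu.hasFDerivAt.sub hv.hasFDerivAt).pow 2).add_const (d ^ 2)).sqrt hpos.ne'
  refine h1.congr_fderiv ?_
  ext w
  have := smoothDist_pos hd (u x) (v x)
  simp only [smoothDist] at this ⊢
  simp
  field_simp

/-- If the gradients of `m` and `M` are complementary convex combinations of those of `u` and `v`,
then testing `m, M` against `φ, ψ` amounts, up to divergences, to testing `u, v` against the
transposed combinations of `φ, ψ`. -/
lemma divergence_exchange {u v m M s : Rn n → ℝ} {φ ψ : Rn n → Rn n} {x : Rn n}
    (hu : DifferentiableAt ℝ u x) (hv : DifferentiableAt ℝ v x) (hs : DifferentiableAt ℝ s x)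
    (hφ : DifferentiableAt ℝ φ x) (hψ : DifferentiableAt ℝ ψ x)
    (hm : HasFDerivAt m (s x • fderiv ℝ u x + (1 - s x) • fderiv ℝ v x) x)
    (hM : HasFDerivAt M ((1 - s x) • fderiv ℝ u x + s x • fderiv ℝ v x) x) :
    m x * divergence φ x + M x * divergence ψ x =
      (u x * divergence (fun y => s y • φ y + (1 - s y) • ψ y) x +
        v x * divergence (fun y => s y • ψ y + (1 - s y) • φ y) x) +
      ((divergence (fun y => m y • φ y) x + divergence (fun y => M y • ψ y) x) -
        (divergence (fun y => u y • (s y • φ y + (1 - s y) • ψ y)) x +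
          divergence (fun y => v y • (s y • ψ y + (1 - s y) • φ y)) x)) := by
  have hs' : DifferentiableAt ℝ (fun y => 1 - s y) x := hs.const_sub 1
  have hX : DifferentiableAt ℝ (fun y => s y • φ y + (1 - s y) • ψ y) x :=
    (hs.fun_smul hφ).fun_add (hs'.fun_smul hψ)
  have hY : DifferentiableAt ℝ (fun y => s y • ψ y + (1 - s y) • φ y) x :=
    (hs.fun_smul hψ).fun_add (hs'.fun_smul hφ)
  -- After the product rule only the gradient terms remain, and they match by regrouping. The
  -- divergences of the combined fields are kept whole, so the gradient of `s` never has to be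
  -- computed.
  rw [divergence_smul hm.differentiableAt hφ, divergence_smul hM.differentiableAt hψ,
    divergence_smul hu hX, divergence_smul hv hY, hm.fderiv, hM.fderiv]
  simp only [map_add, map_smul, smul_eq_mul, smul_apply, add_apply]
  ring

lemma IsTestField.integrable_divergence_smul {f : Rn n → ℝ} {Z : Rn n → Rn n}
    (hZ : IsTestField Z) (hf : ContDiff ℝ 1 f) : Integrable (divergence fun x => f x • Z x) :=
  integrable_divergence (hf.smul hZ.contDiff) (hZ.hasCompactSupport.smul_left (f := f))

lemma IsTestField.integral_divergence_smul {f : Rn n → ℝ} {Z : Rn n → Rn n}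
    (hZ : IsTestField Z) (hf : ContDiff ℝ 1 f) : ∫ x, divergence (fun x => f x • Z x) x = 0 :=
  integral_divergence_eq_zero (hf.smul hZ.contDiff) (hZ.hasCompactSupport.smul_left (f := f))

lemma IsTestField.integrable_mul_divergence {f : Rn n → ℝ} {Z : Rn n → Rn n}
    (hZ : IsTestField Z) (hf : ContDiff ℝ 1 f) : Integrable fun x => f x * divergence Z x :=
  (hf.continuous.mul (continuous_divergence hZ.contDiff)).integrable_of_hasCompactSupport
    (hasCompactSupport_divergence hZ.hasCompactSupport).mul_left

/-- Integrating by parts, the smoothed minimum and maximum of `u, v` tested against `φ, ψ` are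
`u, v` tested against convex combinations of `φ, ψ`. -/
lemma integral_smoothMin_add_smoothMax_le {d : ℝ} (hd : 0 < d) {u v : Rn n → ℝ}
    (hu : ContDiff ℝ 2 u) (hv : ContDiff ℝ 2 v) {a b : ℝ}
    (hua : ∀ X, IsTestField X → ∫ x, u x * divergence X x ≤ a)
    (hvb : ∀ X, IsTestField X → ∫ x, v x * divergence X x ≤ b)
    {φ ψ : Rn n → Rn n} (hφ : IsTestField φ) (hψ : IsTestField ψ) :
    ∫ x, ((u x + v x - smoothDist d (u x) (v x)) / 2 * divergence φ x +
      (u x + v x + smoothDist d (u x) (v x)) / 2 * divergence ψ x) ≤ a + b := by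
  have hu1 : ContDiff ℝ 1 u := hu.of_le (by norm_num)
  have hv1 : ContDiff ℝ 1 v := hv.of_le (by norm_num)
  set r : Rn n → ℝ := fun x => smoothDist d (u x) (v x) with hr
  have hrpos : ∀ x, 0 < r x := fun x => smoothDist_pos hd _ _
  have hr1 : ContDiff ℝ 1 r :=
    (((hu1.sub hv1).pow 2).add contDiff_const).sqrt fun x => by positivity
  -- This is the coefficient of `∇u` in the gradient of `(u + v - r) / 2`; that of `∇v` is `1 - s`,
  -- and the two swap for `(u + v + r) / 2`.
  set s : Rn n → ℝ := fun x => (1 - (u x - v x) / r x) / 2 with hs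
  have hs1 : ContDiff ℝ 1 s :=
    (contDiff_const.sub ((hu1.sub hv1).div hr1 fun x => (hrpos x).ne')).div_const 2
  have hq : ∀ x, |(u x - v x) / r x| ≤ 1 := fun x => by
    rw [abs_div, abs_of_pos (hrpos x), div_le_one (hrpos x)]
    exact abs_sub_le_smoothDist _ _ _
  have hs0 : ∀ x, 0 ≤ s x := fun x => by
    have := (abs_le.1 (hq x)).2
    simp only [hs]; linarith
  have hsle : ∀ x, s x ≤ 1 := fun x => by
    have := (abs_le.1 (hq x)).1
    simp only [hs]; linarith
  have hX := hφ.convexCombination hψ hs1 hs0 hsle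
  have hY := hψ.convexCombination hφ hs1 hs0 hsle
  set X : Rn n → Rn n := fun x => s x • φ x + (1 - s x) • ψ x with hXdef
  set Y : Rn n → Rn n := fun x => s x • ψ x + (1 - s x) • φ x with hYdef
  set m : Rn n → ℝ := fun x => (u x + v x - r x) / 2 with hm
  set M : Rn n → ℝ := fun x => (u x + v x + r x) / 2 with hM
  have hm1 : ContDiff ℝ 1 m := ((hu1.add hv1).sub hr1).div_const 2
  have hM1 : ContDiff ℝ 1 M := ((hu1.add hv1).add hr1).div_const 2
  have hpoint : ∀ x, m x * divergence φ x + M x * divergence ψ x =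
      (u x * divergence X x + v x * divergence Y x) +
      ((divergence (fun x => m x • φ x) x + divergence (fun x => M x • ψ x) x) -
        (divergence (fun x => u x • X x) x + divergence (fun x => v x • Y x) x)) := fun x => by
    have du := hu1.differentiable one_ne_zero x
    have dv := hv1.differentiable one_ne_zero x
    have hdr := hasFDerivAt_smoothDist hd du dv
    refine divergence_exchange du dv (hs1.differentiable one_ne_zero x)
      (hφ.contDiff.differentiable one_ne_zero x) (hψ.contDiff.differentiable one_ne_zero x) ?_ ?_
    · simp only [hm, div_eq_mul_inv]
      refine (((du.hasFDerivAt.add dv.hasFDerivAt).sub hdr).mul_const (2 : ℝ)⁻¹).congr_fderiv ?_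
      ext w
      simp [hs, hr]
      ring
    · simp only [hM, div_eq_mul_inv]
      refine (((du.hasFDerivAt.add dv.hasFDerivAt).add hdr).mul_const (2 : ℝ)⁻¹).congr_fderiv ?_
      ext w
      simp [hs, hr]
      ring
  have hux := hX.integrable_mul_divergence hu1
  have hvy := hY.integrable_mul_divergence hv1
  have hmφ_int := hφ.integrable_divergence_smul hm1
  have hMψ_int := hψ.integrable_divergence_smul hM1
  have huX_int := hX.integrable_divergence_smul hu1
  have hvY_int := hY.integrable_divergence_smul hv1
  have hdiff_int : Integrable fun x =>
      (divergence (fun x => m x • φ x) x + divergence (fun x => M x • ψ x) x) -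
        (divergence (fun x => u x • X x) x + divergence (fun x => v x • Y x) x) :=
    (hmφ_int.add hMψ_int).sub (huX_int.add hvY_int)
  calc ∫ x, (m x * divergence φ x + M x * divergence ψ x)
      = (∫ x, u x * divergence X x) + ∫ x, v x * divergence Y x := by
        rw [integral_congr_ae (ae_of_all _ hpoint), integral_add (hux.fun_add hvy) hdiff_int,
          integral_sub (hmφ_int.fun_add hMψ_int) (huX_int.fun_add hvY_int),
          integral_add hmφ_int hMψ_int, integral_add huX_int hvY_int,
          hφ.integral_divergence_smul hm1,
          hψ.integral_divergence_smul hM1, hX.integral_divergence_smul hu1,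
          hY.integral_divergence_smul hv1, integral_add hux hvy]
        ring
    _ ≤ a + b := add_le_add (hua X hX) (hvb Y hY)

/-! ### Submodularity of the perimeter. -/

lemma setIntegral_divergence_inter_add_union_le {A B : Set (Rn n)} (hA : MeasurableSet A)
    (hB : MeasurableSet B) (hPA : perimeter A ≠ ⊤) (hPB : perimeter B ≠ ⊤)
    {φ ψ : Rn n → Rn n} (hφ : IsTestField φ) (hψ : IsTestField ψ) :
    (∫ x in A ∩ B, divergence φ x) + ∫ x in A ∪ B, divergence ψ x ≤
      (perimeter A).toReal + (perimeter B).toReal := by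
  obtain ⟨u, hu, hu0, hu1, hua, hut⟩ := exists_smooth_approximation hA hPA
  obtain ⟨v, hv, hv0, hv1, hvb, hvt⟩ := exists_smooth_approximation hB hPB
  have hφi := integrable_divergence hφ.contDiff hφ.hasCompactSupport
  have hψi := integrable_divergence hψ.contDiff hψ.hasCompactSupport
  set d : ℕ → ℝ := fun k => 1 / ((k : ℝ) + 1) with hd
  have hdpos : ∀ k, 0 < d k := fun k => Nat.one_div_pos_of_nat
  have hdle : ∀ k, d k ≤ 1 := fun k => by
    rw [hd, div_le_one (by positivity)]
    linarith [(Nat.cast_nonneg k : (0 : ℝ) ≤ k)]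
  have hdt : Tendsto d atTop (𝓝 0) := tendsto_one_div_add_atTop_nhds_zero_nat
  have hrc : ∀ k, Continuous fun x => smoothDist (d k) (u k x) (v k x) := fun k => by
    have := (hu k).continuous
    have := (hv k).continuous
    unfold smoothDist
    fun_prop
  have hr0 : ∀ k x, 0 < smoothDist (d k) (u k x) (v k x) := fun k x => smoothDist_pos (hdpos k) _ _
  have hr2 : ∀ k x, smoothDist (d k) (u k x) (v k x) ≤ 2 := fun k x =>
    smoothDist_le_two (hdpos k).le (hdle k) (hu0 k x) (hu1 k x) (hv0 k x) (hv1 k x)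
  have hlim : Tendsto (fun k => ∫ x,
      ((u k x + v k x - smoothDist (d k) (u k x) (v k x)) / 2 * divergence φ x +
      (u k x + v k x + smoothDist (d k) (u k x) (v k x)) / 2 * divergence ψ x)) atTop
      (𝓝 (∫ x, ((A ∩ B).indicator (divergence φ) x + (A ∪ B).indicator (divergence ψ) x))) := by
    refine tendsto_integral_of_dominated_convergence
      -- The factor `2` is `(1 + 1 + 2) / 2`, from `u, v ≤ 1` and `smoothDist ≤ 2`.
      (fun x => 2 * ‖divergence φ x‖ + 2 * ‖divergence ψ x‖) (fun k => ?_)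
      ((hφi.norm.const_mul 2).add (hψi.norm.const_mul 2)) (fun k => ae_of_all _ fun x => ?_) ?_
    · have := (hu k).continuous
      have := (hv k).continuous
      have := hrc k
      have := continuous_divergence hφ.contDiff
      have := continuous_divergence hψ.contDiff
      exact Continuous.aestronglyMeasurable (by fun_prop)
    · have h1 := hu0 k x
      have h2 := hu1 k x
      have h3 := hv0 k x
      have h4 := hv1 k x
      have h5 := hr0 k x
      have h6 := hr2 k x
      refine (norm_add_le _ _).trans (add_le_add ?_ ?_) <;> rw [norm_mul] <;>
        refine mul_le_mul_of_nonneg_right ?_ (norm_nonneg _) <;> rw [Real.norm_eq_abs, abs_le] <;>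
        constructor <;> linarith
    · filter_upwards [hut, hvt] with x hux hvx
      have hrt := ((((hux.sub hvx).pow 2).add (hdt.pow 2)).sqrt)
      have := ((((hux.add hvx).sub hrt).div_const 2).mul_const (divergence φ x)).add
        ((((hux.add hvx).add hrt).div_const 2).mul_const (divergence ψ x))
      convert this using 1
      congr 1
      -- In the limit the root is `|a - b|` for indicator values `a`, `b`, and `(a + b ∓ |a - b|) /
      -- 2` is their minimum or maximum, the indicator of `A ∩ B` or `A ∪ B`.
      by_cases hxA : x ∈ A <;> by_cases hxB : x ∈ B <;> simp [hxA, hxB]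
  have := le_of_tendsto' hlim fun k => integral_smoothMin_add_smoothMax_le (hdpos k) (hu k) (hv k)
    (hua k) (hvb k) hφ hψ
  rwa [integral_add (hφi.indicator (hA.inter hB)) (hψi.indicator (hA.union hB)),
    integral_indicator (hA.inter hB), integral_indicator (hA.union hB)] at this

/-- Submodularity of the perimeter. -/
theorem perimeter_inter_add_perimeter_union_le {A B : Set (Rn n)}
    (hA : NullMeasurableSet A volume) (hB : NullMeasurableSet B volume) :
    perimeter (A ∩ B) + perimeter (A ∪ B) ≤ perimeter A + perimeter B := by
  obtain ⟨A', hA', hAA⟩ := hA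
  obtain ⟨B', hB', hBB⟩ := hB
  rw [perimeter_congr_ae (hAA.inter hBB), perimeter_congr_ae (hAA.union hBB),
    perimeter_congr_ae hAA, perimeter_congr_ae hBB]
  by_cases hPA : perimeter A' = ⊤
  · simp [hPA]
  by_cases hPB : perimeter B' = ⊤
  · simp [hPB]
  have : Nonempty {φ : Rn n → Rn n // IsTestField φ} := ⟨⟨0, isTestField_zero⟩⟩
  rw [perimeter_eq_iSup_subtype (A' ∩ B'), perimeter_eq_iSup_subtype (A' ∪ B')]
  refine ENNReal.iSup_add_iSup_le fun φ ψ => ?_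
  have key := fun {φ ψ : Rn n → Rn n} (hφ : IsTestField φ) (hψ : IsTestField ψ) =>
    setIntegral_divergence_inter_add_union_le hA' hB' hPA hPB hφ hψ
  have h0 : ∀ x : Rn n, divergence (0 : Rn n → Rn n) x = 0 := fun x => by simp [divergence]
  rw [← ENNReal.ofReal_toReal (ENNReal.add_ne_top.2 ⟨hPA, hPB⟩), ENNReal.toReal_add hPA hPB]
  -- `ENNReal.ofReal` truncates at zero, so a field with nonpositive integral may be replaced by the
  -- zero field.
  rcases le_total (∫ x in A' ∩ B', divergence φ.1 x) 0 with h1 | h1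
  · rw [ENNReal.ofReal_of_nonpos h1, zero_add]
    refine ENNReal.ofReal_le_ofReal ?_
    simpa [h0] using key isTestField_zero ψ.2
  rcases le_total (∫ x in A' ∪ B', divergence ψ.1 x) 0 with h2 | h2
  · rw [ENNReal.ofReal_of_nonpos h2, add_zero]
    refine ENNReal.ofReal_le_ofReal ?_
    simpa [h0] using key φ.2 isTestField_zero
  rw [← ENNReal.ofReal_add h1 h2]
  exact ENNReal.ofReal_le_ofReal (key φ.2 ψ.2)

/-! ### Submodularity of the energy. -/

lemma measurable_abs_signedDistance (E : Set (Rn n)) :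
    Measurable fun x => (signedDistance E x).abs := by
  have habs : ∀ a : ENNReal, (a : EReal).abs = a := fun a => by
    induction a with
    | top => rfl
    | coe a => rw [show ((a : ENNReal) : EReal) = ((a : ℝ) : EReal) from rfl, EReal.abs_def]; simp
  -- One of the two distances vanishes at each point, so the absolute value of their difference is
  -- their sum.
  have : (fun x => (signedDistance E x).abs) =
      fun x => Metric.infEDist x E + Metric.infEDist x Eᶜ := by
    funext x
    by_cases hx : x ∈ E
    · simp [signedDistance, Metric.infEDist_zero_of_mem hx, EReal.abs_neg, habs]
    · simp [signedDistance, Metric.infEDist_zero_of_mem (mem_compl hx), habs]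
  rw [this]
  exact measurable_infEDist.add measurable_infEDist

/-- At each point, membership in `A ∩ B` and `A ∪ B` is a permutation of membership in `A` and `B`,
so the indicators of the symmetric differences have equal sums. -/
lemma setLIntegral_symmDiff_inter_add_union {E A B : Set (Rn n)} {f : Rn n → ENNReal}
    (hf : Measurable f) (hE : NullMeasurableSet E volume) (hA : NullMeasurableSet A volume)
    (hB : NullMeasurableSet B volume) :
    (∫⁻ x in symmDiff (A ∩ B) E, f x) + ∫⁻ x in symmDiff (A ∪ B) E, f x =
      (∫⁻ x in symmDiff A E, f x) + ∫⁻ x in symmDiff B E, f x := by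
  have hm : ∀ {F : Set (Rn n)}, NullMeasurableSet F volume →
      NullMeasurableSet (symmDiff F E) volume := fun hF => (hF.diff hE).union (hE.diff hF)
  rw [← lintegral_indicator₀ (hm (hA.inter hB)), ← lintegral_indicator₀ (hm (hA.union hB)),
    ← lintegral_indicator₀ (hm hA), ← lintegral_indicator₀ (hm hB),
    ← lintegral_add_left' (hf.aemeasurable.indicator₀ (hm (hA.inter hB))),
    ← lintegral_add_left' (hf.aemeasurable.indicator₀ (hm hA))]
  refine lintegral_congr fun x => ?_
  by_cases hxA : x ∈ A <;> by_cases hxB : x ∈ B <;> by_cases hxE : x ∈ E <;>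
    simp [indicator, mem_symmDiff, hxA, hxB, hxE]

/-- Submodularity of the energy. -/
theorem energy_inter_add_energy_union_le (h : ℝ) {E A B : Set (Rn n)}
    (hE : NullMeasurableSet E volume) (hA : NullMeasurableSet A volume)
    (hB : NullMeasurableSet B volume) :
    energy h E (A ∩ B) + energy h E (A ∪ B) ≤ energy h E A + energy h E B := by
  simp only [energy]
  rw [add_add_add_comm, add_add_add_comm (perimeter A), ← mul_add, ← mul_add,
    setLIntegral_symmDiff_inter_add_union (measurable_abs_signedDistance E) hE hA hB]
  exact add_le_add_left (perimeter_inter_add_perimeter_union_le hA hB) _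

lemma FinitePerimeter.inter_and_union {A B : Set (Rn n)} (hA : FinitePerimeter A)
    (hB : FinitePerimeter B) : FinitePerimeter (A ∩ B) ∧ FinitePerimeter (A ∪ B) := by
  have h := (perimeter_inter_add_perimeter_union_le hA.1 hB.1).trans_lt
    (ENNReal.add_lt_top.2 ⟨hA.2, hB.2⟩)
  exact ⟨⟨hA.1.inter hB.1, (ENNReal.add_lt_top.1 h).1⟩, ⟨hA.1.union hB.1, (ENNReal.add_lt_top.1 h).2⟩⟩

/-! ### Comparison of free and constrained minimizers. -/

/-- The union of a free minimizer and a constrained minimizer of finite energy is a constrained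
minimizer. -/
lemma IsMinimizer.union {h : ℝ} {Ω E A B : Set (Rn n)} (hE : NullMeasurableSet E volume)
    (hA : IsMinimizer h ∅ E A) (hB : IsMinimizer h Ω E B) (hfin : energy h E B ≠ ⊤) :
    IsMinimizer h Ω E (A ∪ B) := by
  obtain ⟨hi, hu⟩ := hA.1.inter_and_union hB.1
  -- `B` competes in the free problem, so the energy of `A` is finite and can be cancelled.
  have hAfin : energy h E A ≠ ⊤ := ne_top_of_le_ne_top hfin (hA.2.2 B hB.1 (empty_subset _))
  have hle : energy h E (A ∪ B) ≤ energy h E B := by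
    refine (ENNReal.add_le_add_iff_left hAfin).1 ?_
    exact (add_le_add_left (hA.2.2 _ hi (empty_subset _)) _).trans
      (energy_inter_add_energy_union_le h hE hA.1.1 hB.1.1)
  exact ⟨hu, hB.2.1.trans subset_union_right, fun G hG hΩG => hle.trans (hB.2.2 G hG hΩG)⟩

/-- If no admissible set has finite energy, then the whole space is a minimizer. -/
lemma isMinimizer_univ_of_energy_eq_top {h : ℝ} {Ω E B : Set (Rn n)} (hB : IsMinimizer h Ω E B)
    (htop : energy h E B = ⊤) : IsMinimizer h Ω E univ := by
  refine ⟨⟨MeasurableSet.univ.nullMeasurableSet, by simp [perimeter_univ]⟩, subset_univ _,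
    fun G hG hΩG => ?_⟩
  have := hB.2.2 G hG hΩG
  rw [htop, top_le_iff] at this
  rw [this]
  exact le_top

end ObstacleFlow
end

theorem mainTheorem9 (n : ℕ) (h : ℝ) (hh : 0 < h)
    (Ω E Ef Ec : Set (ObstacleFlow.Rn n))
    (hE : ObstacleFlow.IsMinimizingHull E) (hΩE : Ω ⊆ E)
    (hEf : ObstacleFlow.IsMaximalMinimizer h ∅ E Ef)
    (hEc : ObstacleFlow.IsMaximalMinimizer h Ω E Ec) :
    Ef ≤ᵐ[MeasureTheory.volume] Ec ∧ Ω ⊆ Ec := by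
  refine ⟨?_, hEc.1.2.1⟩
  by_cases htop : ObstacleFlow.energy h E Ec = ⊤
  -- Here maximality is tested against the whole space, which forces `Ec` to have null complement.
  · exact (LE.le.eventuallyLE (subset_univ Ef)).trans
      (hEc.2 _ (ObstacleFlow.isMinimizer_univ_of_energy_eq_top hEc.1 htop))
  -- The null boundary of `E` supplies the measurability that submodularity of the energy requires.
  · exact (LE.le.eventuallyLE subset_union_left).trans
      (hEc.2 _ (hEf.1.union (nullMeasurableSet_of_null_frontier hE.1) hEc.1 htop))
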